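/- For $f:\mathbb{R}^n\to\mathbb{R}$ the regular subdifferential $\widehat\partial f(u)$ is the set of $v\in\mathbb{R}^n$ with $\liminf_{y\to u,\,y\ne u}\frac{f(y)-f(u)-\langle v,y-u\rangle}{\|y-u\|}\ge 0$, and the limiting subdifferential $\partial f(u)$ is the set of all limits $v=\lim_k v_k$ with $v_k\in\widehat\partial f(u_k)$, $u_k\to u$ and $f(u_k)\to f(u)$; let $\operatorname{gph}\partial f=\{(u,v): v\in\partial f(u)\}$. For $(u,v)\in\operatorname{gph}\partial f$ and $w\in\mathbb{R}^n$, the combined second-order subdifferential $\breve\partial^2 f(u,v)(w)$ is the set of $z\in\mathbb{R}^n$ such that $$\limsup_{\substack{(u',v')\to(u,v)\\ (u',v')\in\operatorname{gph}\partial f,\ (u',v')\ne(u,v)}}\frac{\langle z,u'-u\rangle-\langle w,v'-v\rangle}{\|(u'-u,v'-v)\|}\le 0$$ (the condition being void if $(u,v)$ is an isolated point of $\operatorname{gph}\partial f$), and the limiting second-order subdifferential $\partial^2 f(u,v)(w)$ is the set of all limits $z=\lim_k z_k$ with $z_k\in\breve\partial^2 f(u_k,v_k)(w_k)$, $(u_k,v_k)\in\operatorname{gph}\partial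 f$, $(u_k,v_k)\to(u,v)$ and $w_k\to w$. The function $f$ is called lower-$\mathcal{C}^2$ if every point of $\mathbb{R}^n$ has a neighborhood $V$ on which $f(x)=\max_{t\in T}f_t(x)$, where $T$ is a compact topological space, each $f_t$ is of class $\mathcal{C}^2$ on $V$, and $f_t(x)$ and all its partial derivatives in $x$ through order $2$ depend continuously on $(t,x)\in T\times V$. **Theorem 4.1.** Let $f:\mathbb{R}^n\to\mathbb{R}$ be lower-$\mathcal{C}^2$. Then the following assertions are equivalent: (i) $f$ is convex on $\mathbb{R}^n$. (ii) For each $(u,v)\in\operatorname{gph}\partial f$ one has $\langle z,w\rangle\ge 0$ whenever $w\in\mathbb{R}^n$ and $z\in\partial^2 f(u,v)(w)$. (iii) For each $(u,v)\in\operatorname{gph}\partial f$ one has $\langle z,w\rangle\ge 0$ whenever $w\in\mathbb{R}^n$ and $z\in\breve\partial^2 f(u,v)(w)$. -/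

import Mathlib

open Set Filter Topology

/-- Throughout, `X` is a finite-dimensional real Hilbert space (so that weak and norm convergence
of sequences coincide and all outer limits below may be taken in the norm topology), and
extended-real-valued functions are modelled as functions into `EReal`.

`regularSubdiff f u` is the regular (Fréchet) subdifferential: the `v` such that
`liminf_{y → u, y ≠ u} (f y - f u - ⟪v, y - u⟫) / ‖y - u‖ ≥ 0`, and it is empty when `f u` is not
finite. The lower limit is taken in the complete lattice `EReal`. -/
noncomputable def regularSubdiff {X : Type*} [NormedAddCommGroup X] [InnerProductSpace ℝ X]
    (f : X → EReal) (u : X) : Set X :=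
  {v | f u ≠ ⊤ ∧ f u ≠ ⊥ ∧
    0 ≤ liminf (fun y : X => (f y - f u - ((inner ℝ v (y - u) : ℝ) : EReal)) /
      ((‖y - u‖ : ℝ) : EReal)) (𝓝[≠] u)}

/-- The limiting (Mordukhovich) subdifferential: the sequential outer limit of the regular
subdifferentials at `y` as `y → u` with `f y → f u`; it is empty when `f u` is not finite. -/
noncomputable def limitingSubdiff {X : Type*} [NormedAddCommGroup X] [InnerProductSpace ℝ X]
    (f : X → EReal) (u : X) : Set X :=
  {v | f u ≠ ⊤ ∧ f u ≠ ⊥ ∧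
    ∃ (y : ℕ → X) (s : ℕ → X), Tendsto y atTop (𝓝 u) ∧
      Tendsto (fun k => f (y k)) atTop (𝓝 (f u)) ∧ Tendsto s atTop (𝓝 v) ∧
      ∀ k, s k ∈ regularSubdiff f (y k)}

open Classical in
/-- The indicator function of a set in the sense of variational analysis: `0` on `Ω` and `+∞`
off `Ω`. -/
noncomputable def indicatorFun {X : Type*} (Ω : Set X) (x : X) : EReal :=
  if x ∈ Ω then 0 else ⊤

/-- The regular normal cone to `Ω` at `u`: the regular subdifferential of the indicator function
of `Ω` (in particular it is empty for `u ∉ Ω`). -/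
noncomputable def regularNormalCone {X : Type*} [NormedAddCommGroup X] [InnerProductSpace ℝ X]
    (Ω : Set X) (u : X) : Set X :=
  regularSubdiff (indicatorFun Ω) u

/-- The graph of a set-valued mapping `F : X ⇉ X`, in the Hilbert space product `X × X`. -/
def graphOf {X : Type*} (F : X → Set X) : Set (WithLp 2 (X × X)) :=
  {p | p.snd ∈ F p.fst}

/-- The regular coderivative `z ∈ D̂*F(u, v)(w)` iff `(z, -w)` belongs to the regular normal cone
to the graph of `F` at `(u, v)`. -/
noncomputable def regularCoderiv {X : Type*} [NormedAddCommGroup X] [InnerProductSpace ℝ X]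
    (F : X → Set X) (u v w : X) : Set X :=
  {z | WithLp.toLp 2 (z, -w) ∈ regularNormalCone (graphOf F) (WithLp.toLp 2 (u, v))}

/-- The limiting coderivative: the sequential outer limit of `D̂*F(u', v')(w')` as
`(u', v') → (u, v)` and `w' → w`. The points `(u', v')` automatically belong to the graph of `F`,
as the regular coderivative is empty elsewhere. -/
noncomputable def limitingCoderiv {X : Type*} [NormedAddCommGroup X] [InnerProductSpace ℝ X]
    (F : X → Set X) (u v w : X) : Set X :=
  {z | ∃ (u' v' w' z' : ℕ → X), Tendsto u' atTop (𝓝 u) ∧ Tendsto v' atTop (𝓝 v) ∧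
    Tendsto w' atTop (𝓝 w) ∧ Tendsto z' atTop (𝓝 z) ∧
    ∀ k, z' k ∈ regularCoderiv F (u' k) (v' k) (w' k)}

/-- The limiting subdifferential mapping `∂f : X ⇉ X` of a real-valued function. -/
noncomputable def subdiff {X : Type*} [NormedAddCommGroup X] [InnerProductSpace ℝ X]
    (f : X → ℝ) (u : X) : Set X :=
  limitingSubdiff (fun x => (f x : EReal)) u

/-- The combined second-order subdifferential: the regular coderivative of `∂f`. -/
noncomputable def combinedSecondSubdiff {X : Type*} [NormedAddCommGroup X]
    [InnerProductSpace ℝ X] (f : X → ℝ) (u v w : X) : Set X :=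
  regularCoderiv (subdiff f) u v w

/-- The limiting second-order subdifferential: the limiting coderivative of `∂f`. -/
noncomputable def limitingSecondSubdiff {X : Type*} [NormedAddCommGroup X]
    [InnerProductSpace ℝ X] (f : X → ℝ) (u v w : X) : Set X :=
  limitingCoderiv (subdiff f) u v w

/-- `f` is lower-`C²`: around every point there is an (open) neighbourhood `V` on which
`f x = max_{t ∈ T} F t x` (the maximum being attained), where `T` is a compact space, every `F t`
is of class `C²` on `V`, and `F t x` and its derivatives in `x` through order two are continuous
in `(t, x) ∈ T × V`. -/
def IsLowerC2.{t, s} {X : Type s} [NormedAddCommGroup X] [InnerProductSpace ℝ X]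
    (f : X → ℝ) : Prop :=
  ∀ x₀ : X, ∃ V : Set X, IsOpen V ∧ x₀ ∈ V ∧
    ∃ (T : Type t) (_ : TopologicalSpace T) (_ : CompactSpace T) (F : T → X → ℝ),
      (∀ t, ContDiffOn ℝ 2 (F t) V) ∧
      (∀ k : ℕ, k ≤ 2 →
        ContinuousOn (fun p : T × X => iteratedFDeriv ℝ k (F p.1) p.2) (univ ×ˢ V)) ∧
      ∀ x ∈ V, IsGreatest (range fun t => F t x) (f x)

universe u

/-!
A lower-`C²` function `f` is locally weakly convex: an active `C²` piece supports `f` from below up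
to a quadratic error, uniformly on a ball (`IsLowerC2.exists_isQuadSubgradientOn`). Hence on a small
ball the limiting subgradients are exactly the `v` satisfying such a uniform inequality
(`IsQuadSubgradientOn`), and the graph of `∂f` is there closed, bounded in `v` and hypomonotone.

If `f` is convex, then `∂f` is monotone and `id + ∂f` is onto, so the graph of `∂f` is
parametrized by `u + v` with a firmly nonexpansive resolvent. Testing a regular normal `(z, -w)`
along the direction in which `u + v` moves by `t • (z - w)` gives `‖z - w‖ ≤ ‖z + w‖`, that is,
`0 ≤ ⟪z, w⟫` (`inner_nonneg_of_mem_regularCoderiv`); this passes to limits.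

Conversely, fix `(u₀, v₀)` in the graph, a small `lam > 0` and a vector `y` of norm at most one, and
minimize `⟪y, u - lam v⟫ + h (‖u + lam v - (u₀ + lam v₀)‖)` over a compact piece of the graph, where
`h r` is `r` plus a penalty that becomes large away from `0`. At an interior minimizer other than
the centre, Fermat's rule produces a regular normal with `⟪z, w⟫ < 0`
(`not_isLocalMin_graph`). So the centre is the minimizer; making the penalty ever steeper gives
`‖Δu - lam Δv‖ ≤ ‖Δu + lam Δv‖`, which is local monotonicity of `∂f`
(`monotone_of_regularCoderiv_nonneg`). Monotonicity removes the quadratic error in the subgradient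
inequality by repeated bisection, and a continuous function with local affine supports is convex
(`convexOn_of_forall_local_subgradient`).
-/

/-! ### Regular and limiting subgradients -/

section Subgradients

variable {X : Type*} [NormedAddCommGroup X] [InnerProductSpace ℝ X]

/-- The `ε`-form of the regular subdifferential at a point where the function is finite. -/
theorem mem_regularSubdiff_iff {f : X → EReal} {u v : X} {a : ℝ} (ha : f u = a) :
    v ∈ regularSubdiff f u ↔
      ∀ ε > 0, ∀ᶠ y in 𝓝 u, ((a + inner ℝ v (y - u) - ε * ‖y - u‖ : ℝ) : EReal) ≤ f y := by
  have key : ∀ (y : X) (ε : ℝ), y ≠ u →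
      (((-ε : ℝ) : EReal) ≤ (f y - f u - ((inner ℝ v (y - u) : ℝ) : EReal)) /
        ((‖y - u‖ : ℝ) : EReal) ↔
      ((a + inner ℝ v (y - u) - ε * ‖y - u‖ : ℝ) : EReal) ≤ f y) := by
    intro y ε hy
    have hpos : (0 : ℝ) < ‖y - u‖ := norm_pos_iff.2 (sub_ne_zero.2 hy)
    rw [EReal.le_div_iff_mul_le (by exact_mod_cast hpos) (EReal.coe_ne_top _), ha,
      ← EReal.coe_mul]
    induction f y using EReal.rec with
    | bot =>
      simp only [EReal.bot_sub, le_bot_iff]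
      exact iff_of_false (EReal.coe_ne_bot _) (EReal.coe_ne_bot _)
    | top => simp
    | coe b =>
      rw [← EReal.coe_sub, ← EReal.coe_sub, EReal.coe_le_coe_iff, EReal.coe_le_coe_iff]
      constructor <;> intro h <;> linarith
  constructor
  · rintro ⟨-, -, h⟩ ε hε
    have h1 : ((-ε : ℝ) : EReal) < 0 := by exact_mod_cast neg_lt_zero.2 hε
    have h2 := eventually_lt_of_lt_liminf (h1.trans_le h)
    rw [eventually_nhdsWithin_iff] at h2
    filter_upwards [h2] with y hy
    rcases eq_or_ne y u with rfl | hne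
    · simp [ha]
    · exact (key y ε hne).1 (hy hne).le
  · intro h
    refine ⟨by simp [ha], by simp [ha], ?_⟩
    refine le_of_forall_lt fun c hc => ?_
    obtain ⟨c', hcc', hc'0⟩ := EReal.lt_iff_exists_real_btwn.1 hc
    refine hcc'.trans_le (le_liminf_of_le (by isBoundedDefault) ?_)
    have hneg : 0 < -c' := by
      have : c' < 0 := by exact_mod_cast hc'0
      linarith
    rw [eventually_nhdsWithin_iff]
    filter_upwards [h (-c') hneg] with y hy hne
    simpa using (key y (-c') hne).2 hy

/-- `v` is a quadratically perturbed subgradient of `f` at `u` relative to `B`: the function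
`f` lies above `f u + ⟪v, y - u⟫ - ρ ‖y - u‖ ^ 2` on `B`. The case `ρ = 0` is that of a subgradient
in the sense of convex analysis. -/
def IsQuadSubgradientOn (f : X → ℝ) (ρ : ℝ) (B : Set X) (u v : X) : Prop :=
  ∀ y ∈ B, f u + inner ℝ v (y - u) - ρ * ‖y - u‖ ^ 2 ≤ f y

theorem IsQuadSubgradientOn.mem_subdiff {f : X → ℝ} {ρ : ℝ} {B : Set X} {u v : X}
    (h : IsQuadSubgradientOn f ρ B u v) (hB : B ∈ 𝓝 u) : v ∈ subdiff f u := by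
  refine ⟨by simp, by simp, fun _ => u, fun _ => v, tendsto_const_nhds, tendsto_const_nhds,
    tendsto_const_nhds, fun _ => ?_⟩
  rw [mem_regularSubdiff_iff (f := fun x => (f x : EReal)) rfl]
  intro ε hε
  have hlim : Tendsto (fun y : X => ρ * ‖y - u‖) (𝓝 u) (𝓝 0) := by
    have : Continuous fun y : X => ρ * ‖y - u‖ := by fun_prop
    simpa using this.tendsto u
  filter_upwards [hB, hlim.eventually_lt_const hε] with y hy hlt
  rw [EReal.coe_le_coe_iff]
  have h1 := h y hy
  nlinarith [norm_nonneg (y - u)]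

theorem norm_sq_combo (x y : X) {a b : ℝ} (hab : a + b = 1) :
    ‖a • x + b • y‖ ^ 2 = a * ‖x‖ ^ 2 + b * ‖y‖ ^ 2 - a * b * ‖y - x‖ ^ 2 := by
  rw [norm_add_sq_real, norm_sub_sq_real, norm_smul, norm_smul, inner_smul_left,
    inner_smul_right, mul_pow, mul_pow, Real.norm_eq_abs, Real.norm_eq_abs, sq_abs, sq_abs,
    real_inner_comm]
  obtain rfl : b = 1 - a := by linarith
  simp
  ring

/-- Existence of quadratically perturbed subgradients everywhere is weak convexity. -/
theorem convexOn_of_forall_exists_isQuadSubgradientOn {f : X → ℝ} {ρ : ℝ} {B : Set X}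
    (hB : Convex ℝ B) (h : ∀ u ∈ B, ∃ v, IsQuadSubgradientOn f ρ B u v) :
    ConvexOn ℝ B fun x => f x + ρ * ‖x‖ ^ 2 := by
  refine ⟨hB, fun x hx y hy a b ha hb hab => ?_⟩
  obtain ⟨v, hv⟩ := h _ (hB hx hy ha hb hab)
  have hx1 := hv x hx
  have hy1 := hv y hy
  have ex : x - (a • x + b • y) = (-b) • (y - x) := by
    obtain rfl : a = 1 - b := by linarith
    module
  have ey : y - (a • x + b • y) = a • (y - x) := by
    obtain rfl : b = 1 - a := by linarith
    module
  rw [ex, inner_smul_right, norm_smul, mul_pow, Real.norm_eq_abs, sq_abs] at hx1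
  rw [ey, inner_smul_right, norm_smul, mul_pow, Real.norm_eq_abs, sq_abs] at hy1
  have hn := norm_sq_combo x y hab
  simp only [smul_eq_mul]
  rw [hn]
  have h1 := mul_le_mul_of_nonneg_left hx1 ha
  have h2 := mul_le_mul_of_nonneg_left hy1 hb
  obtain rfl : b = 1 - a := by linarith
  nlinarith

/-- For a weakly convex function on an open convex set, the inequality defining a regular
subgradient self-improves from an infinitesimal to a uniform one. -/
theorem isQuadSubgradientOn_of_mem_regularSubdiff {f : X → ℝ} {ρ : ℝ} (hρ : 0 ≤ ρ) {B : Set X}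
    (hc : ConvexOn ℝ B fun x => f x + ρ * ‖x‖ ^ 2) {u v : X} (hu : u ∈ B)
    (hv : v ∈ regularSubdiff (fun x => (f x : EReal)) u) : IsQuadSubgradientOn f ρ B u v := by
  intro y hy
  rw [mem_regularSubdiff_iff (f := fun x => (f x : EReal)) rfl] at hv
  have key : ∀ ε > 0, f u + inner ℝ v (y - u) - ρ * ‖y - u‖ ^ 2 ≤ f y + ε * ‖y - u‖ := by
    intro ε hε
    have hlim : Tendsto (fun t : ℝ => (1 - t) • u + t • y) (𝓝[>] 0) (𝓝 u) := by
      have : Continuous fun t : ℝ => (1 - t) • u + t • y := by fun_prop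
      simpa using (this.tendsto 0).mono_left nhdsWithin_le_nhds
    obtain ⟨t, ht, ht1, ht0⟩ := ((hlim.eventually (hv ε hε)).and
      ((eventually_nhdsWithin_of_eventually_nhds (eventually_lt_nhds one_pos)).and
        self_mem_nhdsWithin)).exists
    have ht0 : 0 < t := ht0
    rw [EReal.coe_le_coe_iff, show (1 - t) • u + t • y - u = t • (y - u) by module,
      inner_smul_right, norm_smul, Real.norm_eq_abs, abs_of_pos ht0] at ht
    have h2 := hc.2 hu hy (sub_nonneg.2 ht1.le) ht0.le (by ring)
    simp only [smul_eq_mul] at h2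
    rw [norm_sq_combo u y (by ring)] at h2
    have h3 : t * (f u + inner ℝ v (y - u) - ρ * (1 - t) * ‖y - u‖ ^ 2) ≤
        t * (f y + ε * ‖y - u‖) := by nlinarith
    have h4 := le_of_mul_le_mul_left h3 ht0
    nlinarith [mul_nonneg hρ (mul_nonneg ht0.le (sq_nonneg ‖y - u‖))]
  refine le_of_forall_pos_le_add fun δ hδ => ?_
  have hp : 0 < ‖y - u‖ + 1 := by positivity
  have h1 := key (δ / (‖y - u‖ + 1)) (by positivity)
  have h2 : δ / (‖y - u‖ + 1) * ‖y - u‖ ≤ δ := by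
    rw [div_mul_eq_mul_div, div_le_iff₀ hp]
    nlinarith
  linarith

theorem isQuadSubgradientOn_of_mem_subdiff {f : X → ℝ} {ρ : ℝ} (hρ : 0 ≤ ρ) {B : Set X}
    (hB : IsOpen B) (hc : ConvexOn ℝ B fun x => f x + ρ * ‖x‖ ^ 2) {u v : X} (hu : u ∈ B)
    (hv : v ∈ subdiff f u) : IsQuadSubgradientOn f ρ B u v := by
  obtain ⟨-, -, x, s, hx, hfx, hs, hmem⟩ := hv
  have hfx' : Tendsto (fun k => f (x k)) atTop (𝓝 (f u)) := by
    simpa using EReal.tendsto_coe.1 hfx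
  intro y hy
  have hlim : Tendsto (fun k => f (x k) + inner ℝ (s k) (y - x k) - ρ * ‖y - x k‖ ^ 2) atTop
      (𝓝 (f u + inner ℝ v (y - u) - ρ * ‖y - u‖ ^ 2)) :=
    (hfx'.add (hs.inner (hx.const_sub y))).sub (((hx.const_sub y).norm.pow 2).const_mul ρ)
  refine le_of_tendsto hlim ?_
  filter_upwards [hx.eventually (hB.mem_nhds hu)] with k hk
  exact isQuadSubgradientOn_of_mem_regularSubdiff hρ hc hk (hmem k) y hy

/-- The subdifferential of a weakly convex function is hypomonotone. -/
theorem IsQuadSubgradientOn.inner_sub_ge {f : X → ℝ} {ρ : ℝ} {B : Set X} {u v u' v' : X}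
    (h : IsQuadSubgradientOn f ρ B u v) (h' : IsQuadSubgradientOn f ρ B u' v')
    (hu : u ∈ B) (hu' : u' ∈ B) :
    -(2 * ρ) * ‖u' - u‖ ^ 2 ≤ inner ℝ (u' - u) (v' - v) := by
  have h1 := h u' hu'
  have h2 := h' u hu
  rw [norm_sub_rev, ← neg_sub u' u, inner_neg_right] at h2
  rw [inner_sub_right, real_inner_comm v', real_inner_comm v]
  linarith

/-! ### Coderivatives -/

/-- The `ε`-form of the regular coderivative. -/
theorem mem_regularCoderiv_iff {F : X → Set X} {u v w z : X} :
    z ∈ regularCoderiv F u v w ↔ v ∈ F u ∧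
      ∀ ε > 0, ∀ᶠ p in 𝓝 (WithLp.toLp 2 (u, v)), p.snd ∈ F p.fst →
        inner ℝ z (p.fst - u) - inner ℝ w (p.snd - v) ≤ ε * ‖p - WithLp.toLp 2 (u, v)‖ := by
  by_cases hm : v ∈ F u
  · have h0 : indicatorFun (graphOf F) (WithLp.toLp 2 (u, v)) = ((0 : ℝ) : EReal) := by
      rw [indicatorFun, if_pos (show WithLp.toLp 2 (u, v) ∈ graphOf F from hm)]
      simp
    have h1 : z ∈ regularCoderiv F u v w ↔ WithLp.toLp 2 (z, -w) ∈
      regularSubdiff (indicatorFun (graphOf F)) (WithLp.toLp 2 (u, v)) := Iff.rfl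
    rw [h1, mem_regularSubdiff_iff h0]
    simp only [hm, true_and]
    refine forall₂_congr fun ε _ => eventually_congr (Eventually.of_forall fun p => ?_)
    by_cases hp : p.snd ∈ F p.fst
    · rw [indicatorFun, if_pos (show p ∈ graphOf F from hp), ← EReal.coe_zero,
        EReal.coe_le_coe_iff, WithLp.prod_inner_apply]
      simp only [hp, true_imp_iff]
      simp only [WithLp.ofLp_sub, Prod.fst_sub, Prod.snd_sub, inner_neg_left, WithLp.ofLp_fst,
        WithLp.ofLp_snd]
      constructor <;> intro h <;> linarith
    · rw [indicatorFun, if_neg (show p ∉ graphOf F from hp)]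
      simp [hp]
  · have h0 : indicatorFun (graphOf F) (WithLp.toLp 2 (u, v)) = ⊤ := by
      rw [indicatorFun, if_neg (show WithLp.toLp 2 (u, v) ∉ graphOf F from hm)]
    simp only [hm, false_and, iff_false]
    exact fun h => h.1 h0

theorem regularCoderiv_subset_limitingCoderiv (F : X → Set X) (u v w : X) :
    regularCoderiv F u v w ⊆ limitingCoderiv F u v w := fun z hz =>
  ⟨fun _ => u, fun _ => v, fun _ => w, fun _ => z, tendsto_const_nhds, tendsto_const_nhds,
    tendsto_const_nhds, tendsto_const_nhds, fun _ => hz⟩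

/-- Fermat's rule: a differentiable function with a local minimum relative to the graph of `F`
has its negative gradient in the regular normal cone. -/
theorem mem_regularCoderiv_of_isLocalMin {F : X → Set X} {u v w z : X} (hm : v ∈ F u)
    {θ : WithLp 2 (X × X) → ℝ} {θ' : WithLp 2 (X × X) →L[ℝ] ℝ}
    (hθ : HasFDerivAt θ θ' (WithLp.toLp 2 (u, v)))
    (hθ' : ∀ p, θ' p = inner ℝ w p.snd - inner ℝ z p.fst)
    (hmin : ∀ᶠ p in 𝓝 (WithLp.toLp 2 (u, v)), p.snd ∈ F p.fst →
      θ (WithLp.toLp 2 (u, v)) ≤ θ p) :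
    z ∈ regularCoderiv F u v w := by
  rw [mem_regularCoderiv_iff]
  refine ⟨hm, fun ε hε => ?_⟩
  filter_upwards [hmin, hθ.isLittleO.def hε] with p hp hle hpF
  have h1 := (le_abs_self _).trans hle
  have h2 := hp hpF
  rw [hθ'] at h1
  simp only [WithLp.sub_fst, WithLp.sub_snd, WithLp.toLp_fst, WithLp.toLp_snd] at h1
  linarith

end Subgradients

/-! ### Lower-`C²` functions are locally weakly convex -/

section LowerC2

variable {X : Type*} [NormedAddCommGroup X] [InnerProductSpace ℝ X] [FiniteDimensional ℝ X]

/-- Around every point, a lower-`C²` function has quadratically perturbed subgradients with a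
uniform constant, namely the gradients of the active pieces. -/
theorem IsLowerC2.exists_isQuadSubgradientOn {f : X → ℝ} (hf : IsLowerC2 f) (x₀ : X) :
    ∃ R > 0, ∃ ρ ≥ 0, ∀ u ∈ Metric.ball x₀ R, ∃ v,
      IsQuadSubgradientOn f ρ (Metric.ball x₀ R) u v := by
  obtain ⟨V, hVo, hxV, T, _, _, F, hF, hcont, hmax⟩ := hf x₀
  obtain ⟨R, hR, hRV⟩ := Metric.nhds_basis_closedBall.mem_iff.1 (hVo.mem_nhds hxV)
  have hK : IsCompact ((univ : Set T) ×ˢ Metric.closedBall x₀ R) :=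
    isCompact_univ.prod (isCompact_closedBall x₀ R)
  obtain ⟨C, hC⟩ := hK.exists_bound_of_continuousOn
    ((hcont 2 le_rfl).mono (prod_mono_right hRV))
  have hBV : Metric.ball x₀ R ⊆ V := Metric.ball_subset_closedBall.trans hRV
  refine ⟨R, hR, max C 0, le_max_right _ _, fun u hu => ?_⟩
  obtain ⟨t, ht⟩ := (hmax u (hBV hu)).1
  have hat : ∀ x ∈ Metric.ball x₀ R, ContDiffAt ℝ 2 (F t) x := fun x hx =>
    (hF t).contDiffAt (hVo.mem_nhds (hBV hx))
  -- the gradient of an active piece `F t` is `max C 0`-Lipschitz on the ball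
  have hlip : ∀ x ∈ Metric.ball x₀ R,
      ‖fderiv ℝ (F t) x - fderiv ℝ (F t) u‖ ≤ max C 0 * ‖x - u‖ := by
    intro x hx
    refine (convex_ball x₀ R).norm_image_sub_le_of_norm_fderiv_le (𝕜 := ℝ)
      (fun z hz => ?_) (fun z hz => ?_) hu hx
    · exact ((hat z hz).fderiv_right (m := 1) (by norm_num)).differentiableAt (by norm_num)
    · rw [← norm_iteratedFDeriv_one, norm_iteratedFDeriv_fderiv]
      exact (hC (t, z) ⟨mem_univ _, Metric.ball_subset_closedBall hz⟩).trans (le_max_left _ _)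
  refine ⟨(InnerProductSpace.toDual ℝ X).symm (fderiv ℝ (F t) u), fun y hy => ?_⟩
  rw [InnerProductSpace.toDual_symm_apply]
  have hseg : segment ℝ u y ⊆ Metric.ball x₀ R := (convex_ball x₀ R).segment_subset hu hy
  have hmv : ‖F t y - F t u - fderiv ℝ (F t) u (y - u)‖ ≤
      max C 0 * ‖y - u‖ * ‖y - u‖ := by
    refine (convex_segment u y).norm_image_sub_le_of_norm_fderiv_le' (𝕜 := ℝ)
      (fun z hz => (hat z (hseg hz)).differentiableAt (by norm_num)) (fun z hz => ?_)
      (left_mem_segment ℝ u y) (right_mem_segment ℝ u y)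
    refine (hlip z (hseg hz)).trans ?_
    gcongr
    exact norm_sub_le_of_mem_segment hz
  have h1 := (neg_le_of_abs_le hmv)
  have h2 : F t y ≤ f y := (hmax y (hBV hy)).2 ⟨t, rfl⟩
  simp only at ht
  nlinarith

theorem continuous_of_forall_exists_isQuadSubgradientOn {f : X → ℝ}
    (h : ∀ x₀ : X, ∃ R > 0, ∃ ρ ≥ 0, ∀ u ∈ Metric.ball x₀ R, ∃ v,
      IsQuadSubgradientOn f ρ (Metric.ball x₀ R) u v) : Continuous f := by
  refine continuous_iff_continuousAt.2 fun x₀ => ?_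
  obtain ⟨R, hR, ρ, -, hs⟩ := h x₀
  have hc := convexOn_of_forall_exists_isQuadSubgradientOn (convex_ball x₀ R) hs
  have h1 := (hc.continuousOn Metric.isOpen_ball).continuousAt (Metric.ball_mem_nhds x₀ hR)
  have h2 : ContinuousAt (fun x : X => ρ * ‖x‖ ^ 2) x₀ := by fun_prop
  exact (h1.sub h2).congr (Eventually.of_forall fun x => by simp)

end LowerC2

/-! ### Positive semidefiniteness for convex functions -/

section Monotone

variable {X : Type*} [NormedAddCommGroup X] [InnerProductSpace ℝ X]

/-- The regular coderivative of a monotone mapping `F` for which `id + F` is onto is positive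
semidefinite. The reason is that the resolvent `(id + F)⁻¹` is firmly nonexpansive, which makes
the graph move by a controlled amount when `u + v` moves in the direction `z - w`. -/
theorem inner_nonneg_of_mem_regularCoderiv {F : X → Set X}
    (hmono : ∀ u v u' v', v ∈ F u → v' ∈ F u' → 0 ≤ inner ℝ (u' - u) (v' - v))
    (hsurj : ∀ p, ∃ u, p - u ∈ F u) {u v w z : X} (hz : z ∈ regularCoderiv F u v w) :
    0 ≤ inner ℝ z w := by
  choose J hJ using hsurj
  rw [mem_regularCoderiv_iff] at hz
  obtain ⟨hv, hz⟩ := hz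
  set d := z - w with hd
  set a : ℝ → X := fun t => J (u + v + t • d) - u with ha
  have hb : ∀ t, u + v + t • d - J (u + v + t • d) - v = t • d - a t := fun t => by
    simp only [ha]; abel
  have hab : ∀ t, 0 ≤ inner ℝ (a t) (t • d - a t) := fun t => by
    rw [← hb]; exact hmono _ _ _ _ hv (hJ _)
  have hexp : ∀ t, ‖t • d‖ ^ 2 = ‖a t‖ ^ 2 + 2 * inner ℝ (a t) (t • d - a t) +
      ‖t • d - a t‖ ^ 2 := fun t => by
    rw [← norm_add_sq_real, add_sub_cancel]
  set γ : ℝ → WithLp 2 (X × X) := fun t =>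
    WithLp.toLp 2 (J (u + v + t • d), u + v + t • d - J (u + v + t • d)) with hγ
  have hγn : ∀ t, 0 ≤ t → ‖γ t - WithLp.toLp 2 (u, v)‖ ≤ t * ‖d‖ := by
    intro t ht
    refine le_of_sq_le_sq ?_ (by positivity)
    rw [WithLp.prod_norm_sq_eq_of_L2]
    simp only [hγ, WithLp.sub_fst, WithLp.sub_snd, WithLp.toLp_fst, WithLp.toLp_snd]
    rw [hb]
    have h1 := hexp t
    rw [norm_smul, Real.norm_eq_abs, abs_of_nonneg ht] at h1
    have h2 := hab t
    change ‖a t‖ ^ 2 + _ ≤ _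
    linarith
  have hlim : Tendsto γ (𝓝[>] 0) (𝓝 (WithLp.toLp 2 (u, v))) := by
    rw [tendsto_iff_norm_sub_tendsto_zero]
    have h0 : Tendsto (fun t : ℝ => t * ‖d‖) (𝓝[>] 0) (𝓝 0) := by
      have : Continuous fun t : ℝ => t * ‖d‖ := by fun_prop
      simpa using (this.tendsto 0).mono_left nhdsWithin_le_nhds
    refine squeeze_zero' (Eventually.of_forall fun _ => norm_nonneg _) ?_ h0
    filter_upwards [self_mem_nhdsWithin] with t ht using hγn t (le_of_lt ht)
  have key : ∀ ε > 0, ‖d‖ * ‖d‖ ≤ ‖d‖ * (‖z + w‖ + 2 * ε) := by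
    intro ε hε
    obtain ⟨t, ht, ht0⟩ := ((hlim.eventually (hz ε hε)).and self_mem_nhdsWithin).exists
    have ht0 : 0 < t := ht0
    have h1 := (ht (hJ _)).trans (mul_le_mul_of_nonneg_left (hγn t ht0.le) hε.le)
    simp only [hγ, WithLp.toLp_fst, WithLp.toLp_snd] at h1
    rw [hb] at h1
    change inner ℝ z (a t) - _ ≤ _ at h1
    -- firm nonexpansiveness confines `a t` to the ball of radius `t * ‖d‖ / 2` about `t • d / 2`
    have hball : ‖a t - (t / 2) • d‖ ≤ t / 2 * ‖d‖ := by
      refine le_of_sq_le_sq ?_ (by positivity)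
      have h2 := hab t
      rw [inner_sub_right, inner_smul_right, real_inner_self_eq_norm_sq] at h2
      rw [norm_sub_sq_real, inner_smul_right, norm_smul, Real.norm_eq_abs,
        abs_of_nonneg (by positivity)]
      nlinarith
    have hcs := neg_le_of_abs_le (abs_real_inner_le_norm (z + w) (a t - (t / 2) • d))
    have hle := mul_le_mul_of_nonneg_left hball (norm_nonneg (z + w))
    have hdd : inner ℝ z d - inner ℝ w d = ‖d‖ ^ 2 := by
      rw [← inner_sub_left, ← hd, real_inner_self_eq_norm_sq]
    rw [inner_sub_right w, inner_smul_right] at h1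
    rw [inner_sub_right, inner_smul_right, inner_add_left, inner_add_left] at hcs
    have hfin : t * (‖d‖ * ‖d‖) ≤ t * (‖d‖ * (‖z + w‖ + 2 * ε)) := by nlinarith
    exact le_of_mul_le_mul_left hfin ht0
  have hnorm : ‖z - w‖ ≤ ‖z + w‖ := by
    rcases (norm_nonneg d).eq_or_lt with h0 | hpos
    · rw [← hd, ← h0]; exact norm_nonneg _
    · refine le_of_forall_pos_le_add fun ε hε => ?_
      have := le_of_mul_le_mul_left (key (ε / 2) (by positivity)) hpos
      rw [← hd]; linarith
  have hsq := pow_le_pow_left₀ (norm_nonneg _) hnorm 2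
  rw [norm_add_sq_real, norm_sub_sq_real] at hsq
  linarith

/-- A real convex function with a subgradient everywhere has proximal points: `p - u` is a
subgradient at the minimizer `u` of `f + ‖· - p‖ ^ 2 / 2`. -/
theorem exists_sub_mem_subdiff [FiniteDimensional ℝ X] {f : X → ℝ} (hcont : Continuous f)
    (p : X) {v : X} (hv : IsQuadSubgradientOn f 0 univ p v) : ∃ u, p - u ∈ subdiff f u := by
  obtain ⟨u, hu⟩ : ∃ u, ∀ x, f u + ‖u - p‖ ^ 2 / 2 ≤ f x + ‖x - p‖ ^ 2 / 2 := by
    have hc : Continuous fun x => f x + ‖x - p‖ ^ 2 / 2 := by fun_prop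
    refine hc.exists_forall_le' p ?_
    have hcomp : (Metric.closedBall p (2 * ‖v‖))ᶜ ∈ cocompact X :=
      (isCompact_closedBall p _).compl_mem_cocompact
    filter_upwards [hcomp] with x hx
    rw [mem_compl_iff, Metric.mem_closedBall, not_le, dist_eq_norm] at hx
    have h1 := hv x (mem_univ x)
    have h2 := neg_le_of_abs_le (abs_real_inner_le_norm v (x - p))
    simp only [sub_self, norm_zero]
    nlinarith [norm_nonneg v]
  refine ⟨u, IsQuadSubgradientOn.mem_subdiff (ρ := 1 / 2) (B := univ) (fun y _ => ?_) univ_mem⟩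
  have h1 := hu y
  have h2 : ‖y - p‖ ^ 2 = ‖y - u‖ ^ 2 - 2 * inner ℝ (p - u) (y - u) + ‖u - p‖ ^ 2 := by
    rw [show y - p = (y - u) - (p - u) by abel, norm_sub_sq_real, real_inner_comm,
      norm_sub_rev p u]
  linarith

end Monotone

/-! ### From the second-order condition to local monotonicity -/

section Variational

variable {X : Type*} [NormedAddCommGroup X] [InnerProductSpace ℝ X]

/-- If the regular coderivative of `F` is positive semidefinite at `(u, v)`, then
`⟪y, u - lam v⟫ + g (‖u + lam v - b‖ ^ 2)` has no local minimum over the graph of `F` at `(u, v)`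
when the second term is steeper than the first: the resulting normal would have
`⟪z, w⟫ = lam (‖y‖ ^ 2 - ‖e‖ ^ 2) < 0`, where `e` is the gradient of the second term in
`u + lam v`. -/
theorem not_isLocalMin_graph {F : X → Set X} {u v : X} (hv : v ∈ F u)
    (hF : ∀ w z, z ∈ regularCoderiv F u v w → 0 ≤ inner ℝ z w) {lam : ℝ} (hlam : 0 < lam)
    {y b : X} {g : ℝ → ℝ} {d : ℝ} (hg : HasDerivAt g d (‖u + lam • v - b‖ ^ 2))
    (hy : ‖y‖ < 2 * d * ‖u + lam • v - b‖)
    (hmin : ∀ᶠ p : WithLp 2 (X × X) in 𝓝 (WithLp.toLp 2 (u, v)), p.snd ∈ F p.fst →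
      inner ℝ y (u - lam • v) + g (‖u + lam • v - b‖ ^ 2) ≤
        inner ℝ y (p.fst - lam • p.snd) + g (‖p.fst + lam • p.snd - b‖ ^ 2)) : False := by
  let A : WithLp 2 (X × X) →L[ℝ] X := WithLp.fstL 2 ℝ X X
  let B : WithLp 2 (X × X) →L[ℝ] X := WithLp.sndL 2 ℝ X X
  set e := (2 * d) • (u + lam • v - b) with he
  have hd1 : HasFDerivAt (fun p : WithLp 2 (X × X) => inner ℝ y (p.fst - lam • p.snd))
      ((innerSL ℝ y).comp (A - lam • B)) (WithLp.toLp 2 (u, v)) :=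
    ((innerSL ℝ y).comp (A - lam • B)).hasFDerivAt
  have hd2 : HasFDerivAt (fun p : WithLp 2 (X × X) => p.fst + lam • p.snd - b)
      (A + lam • B) (WithLp.toLp 2 (u, v)) := (A + lam • B).hasFDerivAt.sub_const b
  have hd3 : HasFDerivAt (fun p : WithLp 2 (X × X) => g (‖p.fst + lam • p.snd - b‖ ^ 2))
      (d • (2 • (innerSL ℝ (u + lam • v - b)).comp (A + lam • B))) (WithLp.toLp 2 (u, v)) :=
    HasDerivAt.comp_hasFDerivAt (WithLp.toLp 2 (u, v)) hg hd2.norm_sq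
  have hmem := mem_regularCoderiv_of_isLocalMin (z := -(y + e)) (w := lam • (e - y)) hv
    (hd1.add hd3) (fun p => by
      have hA : A p = p.fst := rfl
      have hB : B p = p.snd := rfl
      simp only [add_apply, ContinuousLinearMap.comp_apply,
        sub_apply, smul_apply, innerSL_apply_apply, hA, hB,
        inner_sub_right, inner_add_right, inner_smul_right, inner_neg_left, inner_add_left,
        inner_smul_left, inner_sub_left, he, smul_eq_mul, nsmul_eq_mul]
      simp
      ring) hmin
  have h0 := hF _ _ hmem
  rw [inner_smul_right, inner_neg_left, inner_sub_right, inner_add_left, inner_add_left,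
    real_inner_self_eq_norm_sq, real_inner_self_eq_norm_sq, real_inner_comm y e] at h0
  have hen : ‖y‖ < ‖e‖ := by
    refine hy.trans_le ?_
    rw [he, norm_smul, Real.norm_eq_abs]
    gcongr
    exact le_abs_self _
  have hsq : ‖y‖ ^ 2 < ‖e‖ ^ 2 := by gcongr
  nlinarith

/-- If the regular coderivative of a locally bounded, closed and hypomonotone mapping is positive
semidefinite, then the mapping is locally monotone. -/
theorem monotone_of_regularCoderiv_nonneg [FiniteDimensional ℝ X] {F : X → Set X} {x₀ : X}
    {r L κ : ℝ} (hr : 0 < r) (hκ : 0 ≤ κ)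
    (hbd : ∀ u ∈ Metric.closedBall x₀ (8 * r), ∀ v ∈ F u, ‖v‖ ≤ L)
    (hcl : IsClosed {p : X × X | p.1 ∈ Metric.closedBall x₀ (8 * r) ∧ p.2 ∈ F p.1})
    (hhypo : ∀ u ∈ Metric.closedBall x₀ (8 * r), ∀ u' ∈ Metric.closedBall x₀ (8 * r),
      ∀ v ∈ F u, ∀ v' ∈ F u', -κ * ‖u' - u‖ ^ 2 ≤ inner ℝ (u' - u) (v' - v))
    (hF : ∀ u v, v ∈ F u → ∀ w z, z ∈ regularCoderiv F u v w → 0 ≤ inner ℝ z w)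
    {u₀ v₀ u₁ v₁ : X} (hu₀ : u₀ ∈ Metric.ball x₀ r) (hu₁ : u₁ ∈ Metric.ball x₀ r)
    (hv₀ : v₀ ∈ F u₀) (hv₁ : v₁ ∈ F u₁) : 0 ≤ inner ℝ (u₁ - u₀) (v₁ - v₀) := by
  have hsub : Metric.ball x₀ r ⊆ Metric.closedBall x₀ (8 * r) :=
    (Metric.ball_subset_ball (by linarith)).trans Metric.ball_subset_closedBall
  have hL : 0 ≤ L := (norm_nonneg _).trans (hbd _ (hsub hu₀) _ hv₀)
  -- `lam` is small enough for `u + lam v` to determine `u` and to differ little from `u`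
  obtain ⟨lam, hlam, hlamL, hlamκ⟩ : ∃ lam : ℝ, 0 < lam ∧ 2 * lam * L ≤ r ∧ lam * κ < 1 := by
    refine ⟨min (r / (2 * (L + 1))) (1 / (κ + 1)), by positivity, ?_, ?_⟩
    · have h1 := min_le_left (r / (2 * (L + 1))) (1 / (κ + 1))
      rw [le_div_iff₀ (by positivity)] at h1
      have h2 : 0 < min (r / (2 * (L + 1))) (1 / (κ + 1)) := by positivity
      nlinarith
    · have h1 := min_le_right (r / (2 * (L + 1))) (1 / (κ + 1))
      rw [le_div_iff₀ (by positivity)] at h1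
      have h2 : 0 < min (r / (2 * (L + 1))) (1 / (κ + 1)) := by positivity
      nlinarith
  set b := u₀ + lam • v₀ with hb
  have hdv : ∀ u ∈ Metric.closedBall x₀ (8 * r), ∀ v ∈ F u, ‖lam • (v - v₀)‖ ≤ r := by
    intro u hu v hv
    rw [norm_smul, Real.norm_eq_abs, abs_of_pos hlam]
    have h1 := norm_sub_le v v₀
    have h2 := hbd u hu v hv
    have h3 := hbd u₀ (hsub hu₀) v₀ hv₀
    nlinarith
  have hplus : ∀ u v, u + lam • v - b = (u - u₀) + lam • (v - v₀) := fun u v => by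
    rw [hb]; module
  have hminus : ∀ u v, (u - lam • v) - (u₀ - lam • v₀) = (u - u₀) - lam • (v - v₀) :=
    fun u v => by module
  rw [Metric.mem_ball, dist_eq_norm] at hu₀ hu₁
  -- comparison of `⟪y, u - lam v⟫` with a steep function of `‖u + lam v - b‖`
  have key : ∀ y : X, ‖y‖ ≤ 1 → ∀ m : ℕ, 0 ≤ inner ℝ y ((u₁ - u₀) - lam • (v₁ - v₀)) +
      (‖u₁ + lam • v₁ - b‖ + 10 * r * (‖u₁ + lam • v₁ - b‖ ^ 2 / (4 * r) ^ 2) ^ (m + 1)) := by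
    intro y hy m
    set g : ℝ → ℝ := fun s => √s + 10 * r * (s / (4 * r) ^ 2) ^ (m + 1) with hg
    have hgsq : ∀ x : X, g (‖x‖ ^ 2) = ‖x‖ + 10 * r * (‖x‖ ^ 2 / (4 * r) ^ 2) ^ (m + 1) :=
      fun x => by simp only [hg]; rw [Real.sqrt_sq (norm_nonneg x)]
    set θ : X × X → ℝ := fun p =>
      inner ℝ y (p.1 - lam • p.2) + g (‖p.1 + lam • p.2 - b‖ ^ 2) with hθ
    have hθc : Continuous θ := by
      have : Continuous g := by simp only [hg]; fun_prop
      simp only [hθ]; fun_prop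
    have hθdiff : ∀ u v, θ (u, v) - θ (u₀, v₀) =
        inner ℝ y ((u - u₀) - lam • (v - v₀)) + g (‖u + lam • v - b‖ ^ 2) := by
      intro u v
      have h0 : g (‖u₀ + lam • v₀ - b‖ ^ 2) = 0 := by simp [hg, hb]
      rw [← hminus, inner_sub_right]
      simp only [hθ, h0]
      ring
    have hcomp : IsCompact {p : X × X | p.1 ∈ Metric.closedBall x₀ (8 * r) ∧ p.2 ∈ F p.1} :=
      ((isCompact_closedBall x₀ (8 * r)).prod (isCompact_closedBall 0 L)).of_isClosed_subset hcl
        fun p hp => ⟨hp.1, by simpa using hbd p.1 hp.1 p.2 hp.2⟩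
    obtain ⟨⟨u, v⟩, ⟨hu, hv⟩, hmin⟩ := hcomp.exists_isMinOn
      ⟨(u₀, v₀), hsub (by simpa [dist_eq_norm] using hu₀), hv₀⟩ hθc.continuousOn
    simp only at hu hv
    have hmin : ∀ p : X × X, p.1 ∈ Metric.closedBall x₀ (8 * r) → p.2 ∈ F p.1 →
      θ (u, v) ≤ θ p := fun p h1 h2 => hmin ⟨h1, h2⟩
    have hmin0 := hmin (u₀, v₀) (hsub (by simpa [dist_eq_norm] using hu₀)) hv₀
    have hmin1 := hmin (u₁, v₁) (hsub (by simpa [dist_eq_norm] using hu₁)) hv₁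
    by_cases hub : u + lam • v - b = 0
    · -- the minimum is attained at the centre `(u₀, v₀)`
      have h1 : u - u₀ = -(lam • (v - v₀)) := by
        rw [hplus] at hub
        exact eq_neg_of_add_eq_zero_left hub
      have h2 := hhypo u₀ (hsub (by simpa [dist_eq_norm] using hu₀)) u hu v₀ hv₀ v hv
      have h3 : lam * inner ℝ (u - u₀) (v - v₀) = -‖u - u₀‖ ^ 2 := by
        rw [← inner_smul_right, show lam • (v - v₀) = -(u - u₀) by rw [h1, neg_neg],
          inner_neg_right, real_inner_self_eq_norm_sq]
      have h4 : ‖u - u₀‖ ^ 2 ≤ 0 := by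
        have := mul_le_mul_of_nonneg_left h2 hlam.le
        by_contra hcon
        push Not at hcon
        nlinarith
      have h5 : u - u₀ = 0 := by
        have := sq_nonneg ‖u - u₀‖
        have : ‖u - u₀‖ ^ 2 = 0 := le_antisymm h4 this
        simpa using this
      have h6 : lam • (v - v₀) = 0 := by rw [h5] at h1; exact neg_eq_zero.1 h1.symm
      have h7 : θ (u, v) - θ (u₀, v₀) = 0 := by
        rw [hθdiff, hub, h5, h6]
        simp [hg]
      rw [← hgsq, ← hθdiff]
      linarith
    · exfalso
      have hpos : 0 < ‖u + lam • v - b‖ := norm_pos_iff.2 hub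
      -- the penalty keeps the minimizer away from the boundary of the ball
      have hint : ‖u - x₀‖ < 8 * r := by
        by_contra hcon
        push Not at hcon
        have h1 : 7 * r ≤ ‖u - u₀‖ := by
          have := norm_sub_norm_le (u - x₀) (u₀ - x₀)
          rw [sub_sub_sub_cancel_right] at this
          linarith
        have h1' : ‖u - u₀‖ ≤ 9 * r := by
          rw [Metric.mem_closedBall, dist_eq_norm] at hu
          have := norm_sub_le (u - x₀) (u₀ - x₀)
          rw [sub_sub_sub_cancel_right] at this
          linarith
        have h2 := hdv u hu v hv
        have h3 : 6 * r ≤ ‖u + lam • v - b‖ := by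
          rw [hplus]
          have := norm_sub_le_norm_add (u - u₀) (lam • (v - v₀))
          linarith
        have h4 : -(10 * r) ≤ inner ℝ y ((u - u₀) - lam • (v - v₀)) := by
          have h5 := neg_le_of_abs_le
            (abs_real_inner_le_norm y ((u - u₀) - lam • (v - v₀)))
          have h6 := norm_sub_le (u - u₀) (lam • (v - v₀))
          have h7 := mul_le_mul_of_nonneg_right hy
            (norm_nonneg ((u - u₀) - lam • (v - v₀)))
          linarith
        have h5 : 1 ≤ (‖u + lam • v - b‖ ^ 2 / (4 * r) ^ 2) ^ (m + 1) := by
          refine one_le_pow₀ ?_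
          rw [one_le_div (by positivity)]
          gcongr
          linarith
        have h6 := hθdiff u v
        rw [hgsq] at h6
        nlinarith
      have hspos : 0 < ‖u + lam • v - b‖ ^ 2 := by positivity
      have hder := (Real.hasDerivAt_sqrt hspos.ne').add
        ((((hasDerivAt_id (‖u + lam • v - b‖ ^ 2)).div_const ((4 * r) ^ 2)).pow (m + 1)).const_mul
          (10 * r))
      refine not_isLocalMin_graph hv (hF u v hv) hlam (y := y) (b := b) (g := g) hder ?_ ?_
      · rw [Real.sqrt_sq hpos.le]
        refine hy.trans_lt ?_
        rw [mul_add, add_mul]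
        have h1 : 2 * (1 / (2 * ‖u + lam • v - b‖)) * ‖u + lam • v - b‖ = 1 := by
          field_simp
        rw [h1]
        simp only [id]
        exact lt_add_of_pos_right _ (by positivity)
      · have hopen : ∀ᶠ p : WithLp 2 (X × X) in 𝓝 (WithLp.toLp 2 (u, v)),
            p.fst ∈ Metric.ball x₀ (8 * r) :=
          (WithLp.fstL 2 ℝ X X).continuous.continuousAt.eventually
            (Metric.isOpen_ball.mem_nhds (by simpa [dist_eq_norm] using hint))
        filter_upwards [hopen] with p hp hpF
        exact hmin (p.fst, p.snd) (Metric.ball_subset_closedBall hp) hpF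
  -- letting the exponent tend to infinity removes the penalty
  have hrad : ‖u₁ + lam • v₁ - b‖ < 4 * r := by
    rw [hplus]
    have h1 := norm_add_le (u₁ - u₀) (lam • (v₁ - v₀))
    have h2 := hdv u₁ (hsub (by simpa [dist_eq_norm] using hu₁)) v₁ hv₁
    have h3 := norm_sub_le (u₁ - x₀) (u₀ - x₀)
    rw [sub_sub_sub_cancel_right] at h3
    linarith
  have hlimit : ∀ y : X, ‖y‖ ≤ 1 → 0 ≤ inner ℝ y ((u₁ - u₀) - lam • (v₁ - v₀)) +
      ‖u₁ + lam • v₁ - b‖ := by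
    intro y hy
    have hq : ‖u₁ + lam • v₁ - b‖ ^ 2 / (4 * r) ^ 2 < 1 := by
      rw [div_lt_one (by positivity)]
      gcongr
    have hpow := (tendsto_add_atTop_iff_nat 1).2
      (tendsto_pow_atTop_nhds_zero_of_lt_one (by positivity) hq)
    have hlim := ((hpow.const_mul (10 * r)).const_add ‖u₁ + lam • v₁ - b‖).const_add
      (inner ℝ y ((u₁ - u₀) - lam • (v₁ - v₀)))
    rw [mul_zero, add_zero] at hlim
    exact ge_of_tendsto' hlim (key y hy)
  have hnorm : ‖(u₁ - u₀) - lam • (v₁ - v₀)‖ ≤ ‖(u₁ - u₀) + lam • (v₁ - v₀)‖ := by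
    rw [← hplus]
    set q := (u₁ - u₀) - lam • (v₁ - v₀)
    rcases eq_or_ne q 0 with h0 | hne
    · rw [h0, norm_zero]; exact norm_nonneg _
    · have hqpos : 0 < ‖q‖ := norm_pos_iff.2 hne
      have h1 := hlimit (-(‖q‖⁻¹ • q)) (by
        rw [norm_neg, norm_smul, norm_inv, norm_norm, inv_mul_cancel₀ hqpos.ne'])
      rw [inner_neg_left, inner_smul_left, real_inner_self_eq_norm_sq] at h1
      have h2 : (starRingEnd ℝ) ‖q‖⁻¹ * ‖q‖ ^ 2 = ‖q‖ := by
        simp only [conj_trivial]; field_simp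
      linarith
  have hsq := pow_le_pow_left₀ (norm_nonneg _) hnorm 2
  rw [norm_add_sq_real, norm_sub_sq_real, inner_smul_right] at hsq
  exact nonneg_of_mul_nonneg_right (by linarith) hlam

end Variational

/-! ### From local monotonicity to convexity -/

section Globalization

variable {X : Type*} [NormedAddCommGroup X] [InnerProductSpace ℝ X]

/-- Monotonicity halves the constant of a quadratically perturbed subgradient: compare the end
points of a segment with its midpoint. -/
theorem isQuadSubgradientOn_half {f : X → ℝ} {F : X → Set X} {ρ : ℝ} {B : Set X}
    (hB : Convex ℝ B) (hne : ∀ u ∈ B, (F u).Nonempty)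
    (hmono : ∀ u ∈ B, ∀ u' ∈ B, ∀ v ∈ F u, ∀ v' ∈ F u', 0 ≤ inner ℝ (u' - u) (v' - v))
    (hq : ∀ u ∈ B, ∀ v ∈ F u, IsQuadSubgradientOn f ρ B u v) :
    ∀ u ∈ B, ∀ v ∈ F u, IsQuadSubgradientOn f (ρ / 2) B u v := by
  intro u hu v hv y hy
  set c := (1 / 2 : ℝ) • (y - u) with hc
  have hm : u + c ∈ B := by
    have h := hB hu hy (by norm_num : (0 : ℝ) ≤ 1 / 2) (by norm_num : (0 : ℝ) ≤ 1 / 2)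
      (by norm_num)
    convert h using 1
    rw [hc]; module
  obtain ⟨v', hv'⟩ := hne _ hm
  have h1 := hq u hu v hv _ hm
  have h2 := hq _ hm v' hv' y hy
  have h3 := hmono u hu _ hm v hv v' hv'
  rw [add_sub_cancel_left] at h1 h3
  rw [show y - (u + c) = c by rw [hc]; module] at h2
  have h4 : y - u = (2 : ℝ) • c := by rw [hc]; module
  rw [h4, inner_smul_right, norm_smul, Real.norm_eq_abs, abs_two]
  rw [inner_sub_right, real_inner_comm, real_inner_comm v] at h3
  nlinarith

theorem isQuadSubgradientOn_zero_of_monotone {f : X → ℝ} {F : X → Set X} {ρ : ℝ} {B : Set X}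
    (hB : Convex ℝ B) (hne : ∀ u ∈ B, (F u).Nonempty)
    (hmono : ∀ u ∈ B, ∀ u' ∈ B, ∀ v ∈ F u, ∀ v' ∈ F u', 0 ≤ inner ℝ (u' - u) (v' - v))
    (hq : ∀ u ∈ B, ∀ v ∈ F u, IsQuadSubgradientOn f ρ B u v) {u v : X} (hu : u ∈ B)
    (hv : v ∈ F u) : IsQuadSubgradientOn f 0 B u v := by
  have hk : ∀ k : ℕ, ∀ u ∈ B, ∀ v ∈ F u, IsQuadSubgradientOn f (ρ * (1 / 2) ^ k) B u v := by
    intro k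
    induction k with
    | zero => simpa using hq
    | succ k ih =>
      have := isQuadSubgradientOn_half hB hne hmono ih
      rwa [show ρ * (1 / 2) ^ k / 2 = ρ * (1 / 2) ^ (k + 1) by ring] at this
  intro y hy
  have hpow : Tendsto (fun k : ℕ => (1 / 2 : ℝ) ^ k) atTop (𝓝 0) :=
    tendsto_pow_atTop_nhds_zero_of_lt_one (by norm_num) (by norm_num)
  have hlim := ((hpow.const_mul ρ).mul_const (‖y - u‖ ^ 2)).const_sub (f u + inner ℝ v (y - u))
  rw [mul_zero] at hlim
  exact le_of_tendsto' hlim fun k => hk k u hu v hv y hy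

/-- A continuous function with a local affine support at each point is convex. On a segment, the
difference with the chord cannot have a positive maximum: local supports make the set of
maximizers open as well as closed. -/
theorem convexOn_of_forall_local_subgradient {f : X → ℝ} (hf : Continuous f)
    (h : ∀ u, ∃ v, ∃ B ∈ 𝓝 u, IsQuadSubgradientOn f 0 B u v) : ConvexOn ℝ univ f := by
  refine ⟨convex_univ, fun x _ y _ a b ha hb hab => ?_⟩
  set φ : ℝ → ℝ := fun t => f (x + t • (y - x)) - f x - t * (f y - f x) with hφ
  have hφc : Continuous φ := by simp only [hφ]; fun_prop
  suffices hle : φ b ≤ 0 by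
    obtain rfl : a = 1 - b := by linarith
    simp only [hφ] at hle
    rw [show (1 - b) • x + b • y = x + b • (y - x) by module]
    simp only [smul_eq_mul]
    linarith
  by_contra! hpos
  have hbI : b ∈ Icc (0 : ℝ) 1 := ⟨hb, by linarith⟩
  obtain ⟨τ, hτ, hτmax⟩ := isCompact_Icc.exists_isMaxOn ⟨b, hbI⟩ hφc.continuousOn
  have hScl : IsClosed {t : ℝ | φ τ ≤ φ t} := isClosed_le continuous_const hφc
  -- the first maximizer
  obtain ⟨s, ⟨hsI, hsmax⟩, hsleast⟩ := (isCompact_Icc.inter_right hScl).exists_isLeast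
    ⟨τ, hτ, le_refl (φ τ)⟩
  have hsmax : φ τ ≤ φ s := hsmax
  have hs0 : 0 < φ s := hpos.trans_le ((hτmax hbI).trans hsmax)
  have hφ0 : φ 0 = 0 := by simp [hφ]
  have hφ1 : φ 1 = 0 := by simp [hφ]
  have h0s : 0 < s := hsI.1.lt_of_ne (by rintro rfl; exact hs0.ne' hφ0)
  have hs1 : s < 1 := hsI.2.lt_of_ne (by rintro rfl; exact hs0.ne' hφ1)
  obtain ⟨v, B, hB, hv⟩ := h (x + s • (y - x))
  set c : ℝ := inner ℝ v (y - x) - (f y - f x) with hc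
  have hloc : ∀ᶠ t in 𝓝 s, φ s + c * (t - s) ≤ φ t ∧ t ∈ Icc (0 : ℝ) 1 := by
    have hcont : Continuous fun t : ℝ => x + t • (y - x) := by fun_prop
    filter_upwards [hcont.continuousAt.eventually hB, Icc_mem_nhds h0s hs1] with t ht htI
    refine ⟨?_, htI⟩
    have := hv _ ht
    rw [show x + t • (y - x) - (x + s • (y - x)) = (t - s) • (y - x) by module,
      inner_smul_right] at this
    simp only [hφ, hc]
    linarith
  have hadd : Tendsto (fun δ : ℝ => s + δ) (𝓝[>] 0) (𝓝 s) := by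
    have : Continuous fun δ : ℝ => s + δ := by fun_prop
    simpa using (this.tendsto 0).mono_left nhdsWithin_le_nhds
  have hsub : Tendsto (fun δ : ℝ => s - δ) (𝓝[>] 0) (𝓝 s) := by
    have : Continuous fun δ : ℝ => s - δ := by fun_prop
    simpa using (this.tendsto 0).mono_left nhdsWithin_le_nhds
  obtain ⟨δ, ⟨⟨h1, h1I⟩, h2, h2I⟩, hδ⟩ := (((hadd.eventually hloc).and
    (hsub.eventually hloc)).and self_mem_nhdsWithin).exists
  have hδ : 0 < δ := hδ
  have h3 : φ (s + δ) ≤ φ τ := hτmax h1I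
  have h4 : c * δ ≤ 0 := by linarith [show c * (s + δ - s) = c * δ by ring]
  have h5 : s ≤ s - δ := hsleast ⟨h2I, show φ τ ≤ φ (s - δ) by
    linarith [show c * (s - δ - s) = -(c * δ) by ring]⟩
  linarith

end Globalization

/-! ### The two implications -/

section Characterization

variable {X : Type*} [NormedAddCommGroup X] [InnerProductSpace ℝ X] [FiniteDimensional ℝ X]

theorem ConvexOn.inner_nonneg_of_mem_limitingSecondSubdiff {f : X → ℝ} (hf : IsLowerC2 f)
    (hc : ConvexOn ℝ univ f) {u v w z : X} (hz : z ∈ limitingSecondSubdiff f u v w) :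
    0 ≤ inner ℝ z w := by
  have hc' : ConvexOn ℝ univ fun x => f x + 0 * ‖x‖ ^ 2 := by simpa using hc
  have hglob : ∀ {u v : X}, v ∈ subdiff f u → IsQuadSubgradientOn f 0 univ u v := fun h =>
    isQuadSubgradientOn_of_mem_subdiff le_rfl isOpen_univ hc' (mem_univ _) h
  have hcont := continuous_of_forall_exists_isQuadSubgradientOn hf.exists_isQuadSubgradientOn
  obtain ⟨u', v', w', z', -, -, hw, hz, hmem⟩ := hz
  refine ge_of_tendsto' (hz.inner hw) fun k => inner_nonneg_of_mem_regularCoderiv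
    (fun u v u' v' hv hv' => ?_) (fun p => ?_) (hmem k)
  · simpa using (hglob hv).inner_sub_ge (hglob hv') (mem_univ _) (mem_univ _)
  · obtain ⟨R, hR, ρ, -, hs⟩ := hf.exists_isQuadSubgradientOn p
    obtain ⟨v, hv⟩ := hs p (Metric.mem_ball_self hR)
    exact exists_sub_mem_subdiff hcont p (hglob (hv.mem_subdiff (Metric.ball_mem_nhds p hR)))

/-- Perturbed subgradients of a continuous function are locally bounded: test the inequality at
distance `r` in the direction of `v`. -/
theorem exists_norm_le_of_isQuadSubgradientOn {f : X → ℝ} (hf : Continuous f) {x₀ : X}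
    {r ρ : ℝ} (hr : 0 < r) (hρ : 0 ≤ ρ) {B : Set X} (hB : Metric.closedBall x₀ (9 * r) ⊆ B) :
    ∃ L, ∀ u ∈ Metric.closedBall x₀ (8 * r), ∀ v, IsQuadSubgradientOn f ρ B u v → ‖v‖ ≤ L := by
  obtain ⟨M, hM⟩ := (isCompact_closedBall x₀ (9 * r)).exists_bound_of_continuousOn hf.continuousOn
  refine ⟨(2 * M + ρ * r ^ 2) / r, fun u hu v hv => ?_⟩
  have hu9 : u ∈ Metric.closedBall x₀ (9 * r) :=
    Metric.closedBall_subset_closedBall (by linarith) hu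
  rw [le_div_iff₀ hr]
  have hMu := hM u hu9
  rcases eq_or_ne v 0 with rfl | hne
  · have hM0 := (norm_nonneg _).trans hMu
    rw [norm_zero, zero_mul]
    positivity
  · have hpos : 0 < ‖v‖ := norm_pos_iff.2 hne
    have hnorm : ‖(r / ‖v‖) • v‖ = r := by
      rw [norm_smul, Real.norm_eq_abs, abs_of_pos (by positivity), div_mul_cancel₀ _ hpos.ne']
    have hy : u + (r / ‖v‖) • v ∈ Metric.closedBall x₀ (9 * r) := by
      rw [Metric.mem_closedBall, dist_eq_norm] at hu ⊢
      have := norm_add_le (u - x₀) ((r / ‖v‖) • v)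
      rw [show u + (r / ‖v‖) • v - x₀ = u - x₀ + (r / ‖v‖) • v by abel]
      linarith
    have h1 := hv _ (hB hy)
    rw [add_sub_cancel_left, hnorm, inner_smul_right, real_inner_self_eq_norm_sq,
      show r / ‖v‖ * ‖v‖ ^ 2 = ‖v‖ * r by field_simp] at h1
    have h2 := (le_abs_self _).trans (hM _ hy)
    have h3 := neg_le_of_abs_le hMu
    linarith

theorem convexOn_of_combinedSecondSubdiff_nonneg {f : X → ℝ} (hf : IsLowerC2 f)
    (h : ∀ u v, v ∈ subdiff f u → ∀ w z, z ∈ combinedSecondSubdiff f u v w → 0 ≤ inner ℝ z w) :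
    ConvexOn ℝ univ f := by
  have hcont := continuous_of_forall_exists_isQuadSubgradientOn hf.exists_isQuadSubgradientOn
  refine convexOn_of_forall_local_subgradient hcont fun x₀ => ?_
  obtain ⟨R, hR, ρ, hρ, hs⟩ := hf.exists_isQuadSubgradientOn x₀
  have hwc := convexOn_of_forall_exists_isQuadSubgradientOn (convex_ball x₀ R) hs
  have hsub : ∀ u ∈ Metric.ball x₀ R, ∀ v,
      v ∈ subdiff f u ↔ IsQuadSubgradientOn f ρ (Metric.ball x₀ R) u v := fun u hu v =>
    ⟨fun hv => isQuadSubgradientOn_of_mem_subdiff hρ Metric.isOpen_ball hwc hu hv,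
      fun hv => hv.mem_subdiff (Metric.isOpen_ball.mem_nhds hu)⟩
  obtain ⟨r, hr, hrR⟩ : ∃ r : ℝ, 0 < r ∧ 9 * r < R := ⟨R / 10, by positivity, by linarith⟩
  have h9 : Metric.closedBall x₀ (9 * r) ⊆ Metric.ball x₀ R :=
    Metric.closedBall_subset_ball hrR
  have h8 : Metric.closedBall x₀ (8 * r) ⊆ Metric.ball x₀ R :=
    Metric.closedBall_subset_ball (by linarith)
  have h1 : Metric.ball x₀ r ⊆ Metric.ball x₀ R := Metric.ball_subset_ball (by linarith)
  obtain ⟨L, hL⟩ := exists_norm_le_of_isQuadSubgradientOn hcont hr hρ h9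
  have hcl : IsClosed {p : X × X |
      p.1 ∈ Metric.closedBall x₀ (8 * r) ∧ p.2 ∈ subdiff f p.1} := by
    have heq : {p : X × X | p.1 ∈ Metric.closedBall x₀ (8 * r) ∧ p.2 ∈ subdiff f p.1} =
        {p : X × X | p.1 ∈ Metric.closedBall x₀ (8 * r)} ∩ ⋂ y ∈ Metric.ball x₀ R,
          {p : X × X | f p.1 + inner ℝ p.2 (y - p.1) - ρ * ‖y - p.1‖ ^ 2 ≤ f y} := by
      ext p
      simp only [mem_ofPred_eq, mem_inter_iff, mem_iInter]
      exact and_congr_right fun hp => hsub p.1 (h8 hp) p.2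
    rw [heq]
    refine (Metric.isClosed_closedBall.preimage continuous_fst).inter
      (isClosed_biInter fun y _ => isClosed_le ?_ continuous_const)
    fun_prop
  have hmono : ∀ u ∈ Metric.ball x₀ r, ∀ u' ∈ Metric.ball x₀ r, ∀ v ∈ subdiff f u,
      ∀ v' ∈ subdiff f u', 0 ≤ inner ℝ (u' - u) (v' - v) := by
    intro u hu u' hu' v hv v' hv'
    refine monotone_of_regularCoderiv_nonneg hr (mul_nonneg zero_le_two hρ)
      (fun u hu v hv => hL u hu v ((hsub u (h8 hu) v).1 hv)) hcl ?_ h hu hu' hv hv'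
    intro u hu u' hu' v hv v' hv'
    exact ((hsub u (h8 hu) v).1 hv).inner_sub_ge ((hsub u' (h8 hu') v').1 hv') (h8 hu) (h8 hu')
  have hne : ∀ u ∈ Metric.ball x₀ r, (subdiff f u).Nonempty := fun u hu =>
    (hs u (h1 hu)).imp fun v hv => (hsub u (h1 hu) v).2 hv
  obtain ⟨v, hv⟩ := hne x₀ (Metric.mem_ball_self hr)
  exact ⟨v, Metric.ball x₀ r, Metric.ball_mem_nhds x₀ hr,
    isQuadSubgradientOn_zero_of_monotone (convex_ball x₀ r) hne hmono
      (fun u hu v hv y hy => (hsub u (h1 hu) v).1 hv y (h1 hy)) (Metric.mem_ball_self hr) hv⟩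

end Characterization

theorem theorem4p1 (n : ℕ) (f : EuclideanSpace ℝ (Fin n) → ℝ)
    (hf : IsLowerC2.{u} f) :
    (ConvexOn ℝ Set.univ f ↔
      ∀ u v : EuclideanSpace ℝ (Fin n), v ∈ subdiff f u →
        ∀ w z : EuclideanSpace ℝ (Fin n), z ∈ limitingSecondSubdiff f u v w →
          0 ≤ inner ℝ z w) ∧
    (ConvexOn ℝ Set.univ f ↔
      ∀ u v : EuclideanSpace ℝ (Fin n), v ∈ subdiff f u →
        ∀ w z : EuclideanSpace ℝ (Fin n), z ∈ combinedSecondSubdiff f u v w →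
          0 ≤ inner ℝ z w) := by
  have himp := fun hc : ConvexOn ℝ Set.univ f => fun (u v : EuclideanSpace ℝ (Fin n))
      (_ : v ∈ subdiff f u) (w z : EuclideanSpace ℝ (Fin n))
      (hz : z ∈ limitingSecondSubdiff f u v w) =>
    hc.inner_nonneg_of_mem_limitingSecondSubdiff hf hz
  refine ⟨⟨himp, fun h => convexOn_of_combinedSecondSubdiff_nonneg hf
      fun u v hv w z hz => h u v hv w z (regularCoderiv_subset_limitingCoderiv _ _ _ _ hz)⟩,
    fun hc u v hv w z hz => himp hc u v hv w z (regularCoderiv_subset_limitingCoderiv _ _ _ _ hz),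
    fun h => convexOn_of_combinedSecondSubdiff_nonneg hf h⟩
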